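/- For each $n\ge 1$ let $Z,M,R$ be random vectors in $\mathbb R^n$ (treatment, mediator, outcome; the dependence on $n$ is suppressed) satisfying the single level mediation model $$M=ZA+E_1,\qquad R=ZC+MB+E_2,\qquad \operatorname{vec}(E_1\ E_2)\sim\mathcal N(0,\Sigma\otimes I_n),\qquad \Sigma=\begin{pmatrix}\sigma_1^2&\delta\sigma_1\sigma_2\\ \delta\sigma_1\sigma_2&\sigma_2^2\end{pmatrix},$$ with real coefficients $A,B,C$ and known $\sigma_1,\sigma_2>0$, $\delta\in(-1,1)$, where $Z$ is either fixed or random and independent of $(E_1,E_2)$. Suppose that $Z^\top Z/n\to q$ (in probability, if $Z$ is random) as $n\to\infty$, for a constant $q>0$. Put $$\hat A=\frac{Z^\top M}{Z^\top Z},\qquad \hat C'=\frac{Z^\top R}{Z^\top Z},\qquad \hat C=\frac{M^\top M\,Z^\top R-Z^\top M\,M^\top R}{Z^\top Z\,M^\top M-M^\top Z\,Z^\top M}+\frac{\delta\sigma_2 Z^\top M}{\sigma_1Z^\top Z},$$ $$\hat B=\frac{Z^\top Z\,M^\top R-M^\top Z\,Z^\top R}{Z^\top Z\,M^\top M-M^\top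 Z\,Z^\top M}-\frac{\delta\sigma_2}{\sigma_1}.$$ For every $n\ge2$, almost surely on $\{Z\ne0\}$, the matrix $\hat\Theta=\begin{pmatrix}\hat A&\hat C\\0&\hat B\end{pmatrix}$ is the unique maximizer of the log-likelihood $$\ell(\Theta,\Sigma)=-n\log\det\Sigma-\operatorname{tr}\big((Y-X\Theta)\Sigma^{-1}(Y-X\Theta)^\top\big),\qquad Y=(M\ R),\ X=(Z\ M),$$ over the real $2\times2$ matrices $\Theta$ with $\Theta_{21}=0$. The product estimator $\hat A\hat B$ and the difference estimator $\hat C'-\hat C$ of the indirect effect $AB$ are asymptotically equivalent, that is, $\sqrt n\,\big(\hat A\hat B-(\hat C'-\hat C)\big)\to0$ in probability, and both have the same asymptotic distribution: $$\sqrt n\,(\hat A\hat B-AB)\xrightarrow{\mathcal D}\mathcal N\Big(0,\ \frac{\sigma_1^2}{q}B^2+\frac{\sigma_2^2(1-\delta^2)}{\sigma_1^2}A^2\Big),\qquad \sqrt n\,(\hat C'-\hat C-AB)\xrightarrow{\mathcal D}\mathcal N\Big(0,\ \frac{\sigma_1^2}{q}B^2+\frac{\sigma_2^2(1-\delta^2)}{\sigma_1^2}A^2\Big).$$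 -/

import Mathlib

open MeasureTheory ProbabilityTheory Filter Topology Matrix
open scoped Kronecker

noncomputable section

namespace Mediation

/-- The `n × 2` matrix with columns `u` and `v`. -/
def cols {n : ℕ} (u v : Fin n → ℝ) : Matrix (Fin n) (Fin 2) ℝ :=
  Matrix.of fun i => ![u i, v i]

/-- The covariance matrix of one pair of errors. -/
def errorCov (σ₁ σ₂ δ : ℝ) : Matrix (Fin 2) (Fin 2) ℝ :=
  !![σ₁ ^ 2, δ * σ₁ * σ₂; δ * σ₁ * σ₂, σ₂ ^ 2]

/-- The single level mediation model with `n` observations, treatment `Z`, mediator `M` and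
outcome `R`: `M = Z A + E₁`, `R = Z C + M B + E₂`, where `vec (E₁ E₂) ∼ N(0, Σ ⊗ Iₙ)`. The treatment
may be random, independent of the errors; a fixed design is the case of a constant `Z`. -/
structure Model {Ω : Type*} [MeasurableSpace Ω] (P : Measure Ω) (A B C σ₁ σ₂ δ : ℝ) {n : ℕ}
    (Z M R E₁ E₂ : Ω → Fin n → ℝ) : Prop where
  aemeasurable_treatment : AEMeasurable Z P
  mediator_eq : ∀ ω, M ω = A • Z ω + E₁ ω
  outcome_eq : ∀ ω, R ω = C • Z ω + B • M ω + E₂ ω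
  errors_law : HasLaw
    (fun ω => (WithLp.toLp 2 (Matrix.vec (cols (E₁ ω) (E₂ ω))) : EuclideanSpace ℝ (Fin 2 × Fin n)))
    (multivariateGaussian 0 (errorCov σ₁ σ₂ δ ⊗ₖ (1 : Matrix (Fin n) (Fin n) ℝ))) P
  indep : IndepFun Z (fun ω => (E₁ ω, E₂ ω)) P

/-- The log-likelihood of `Θ` and `Σ` (called `S`) in the regression `Y = X Θ + E`. -/
def logLik {n : ℕ} (Y X : Matrix (Fin n) (Fin 2) ℝ) (Θ S : Matrix (Fin 2) (Fin 2) ℝ) : ℝ :=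
  -(n : ℝ) * Real.log S.det - ((Y - X * Θ) * S⁻¹ * (Y - X * Θ)ᵀ).trace

/-- `Θ` maximizes the log-likelihood for known `S`, with response `(M R)` and regressors `(Z M)`,
among all the matrices whose entry in the second row and first column is zero. -/
def IsConstrainedMLE {n : ℕ} (S : Matrix (Fin 2) (Fin 2) ℝ) (Z M R : Fin n → ℝ)
    (Θ : Matrix (Fin 2) (Fin 2) ℝ) : Prop :=
  Θ 1 0 = 0 ∧ ∀ Θ' : Matrix (Fin 2) (Fin 2) ℝ, Θ' 1 0 = 0 →
    logLik (cols M R) (cols Z M) Θ' S ≤ logLik (cols M R) (cols Z M) Θ S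

/-- The estimator of `A`. -/
def hatA {n : ℕ} (Z M : Fin n → ℝ) : ℝ := (Z ⬝ᵥ M) / (Z ⬝ᵥ Z)

/-- The estimator of `C`, the direct effect. -/
def hatC {n : ℕ} (σ₁ σ₂ δ : ℝ) (Z M R : Fin n → ℝ) : ℝ :=
  ((M ⬝ᵥ M) * (Z ⬝ᵥ R) - (Z ⬝ᵥ M) * (M ⬝ᵥ R)) / ((Z ⬝ᵥ Z) * (M ⬝ᵥ M) - (M ⬝ᵥ Z) * (Z ⬝ᵥ M))
    + δ * σ₂ * (Z ⬝ᵥ M) / (σ₁ * (Z ⬝ᵥ Z))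

/-- The estimator of `B`. -/
def hatB {n : ℕ} (σ₁ σ₂ δ : ℝ) (Z M R : Fin n → ℝ) : ℝ :=
  ((Z ⬝ᵥ Z) * (M ⬝ᵥ R) - (M ⬝ᵥ Z) * (Z ⬝ᵥ R)) / ((Z ⬝ᵥ Z) * (M ⬝ᵥ M) - (M ⬝ᵥ Z) * (Z ⬝ᵥ M))
    - δ * σ₂ / σ₁

/-- The estimator of the total effect `C' = C + A B`. -/
def hatC' {n : ℕ} (Z R : Fin n → ℝ) : ℝ := (Z ⬝ᵥ R) / (Z ⬝ᵥ Z)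

/-- The product estimator of the indirect effect `A B`. -/
def productEst {n : ℕ} (σ₁ σ₂ δ : ℝ) (Z M R : Fin n → ℝ) : ℝ :=
  hatA Z M * hatB σ₁ σ₂ δ Z M R

/-- The difference estimator of the indirect effect `A B`. -/
def differenceEst {n : ℕ} (σ₁ σ₂ δ : ℝ) (Z M R : Fin n → ℝ) : ℝ :=
  hatC' Z R - hatC σ₁ σ₂ δ Z M R

/-- Two sequences of `√n`-rate estimators are asymptotically equivalent if `√n` times their
difference tends to zero in probability. -/
def AsymptoticallyEquivalent {Ω : Type*} [MeasurableSpace Ω] (P : Measure Ω) (S T : ℕ → Ω → ℝ) :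
    Prop :=
  TendstoInMeasure P (fun (n : ℕ) ω => √(n : ℝ) * (S n ω - T n ω)) atTop (fun _ => 0)

/-- `√n (Tₙ - θ)` converges in distribution to `N(0, v)`. -/
def AsymptoticallyNormal {Ω : Type*} [MeasurableSpace Ω] (P : Measure Ω) [IsProbabilityMeasure P]
    (T : ℕ → Ω → ℝ) (θ v : ℝ) : Prop :=
  0 ≤ v ∧ TendstoInDistribution (fun (n : ℕ) ω => √(n : ℝ) * (T n ω - θ)) atTop
    (id : ℝ → ℝ) (fun _ => P) (gaussianReal 0 v.toNNReal)

end Mediation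

end

namespace Mediation

/-! ### Convergence in probability and in distribution -/

section Convergence

variable {Ω : Type*} [MeasurableSpace Ω] {P : Measure Ω}

/-! Let κ = δσ₂/σ₁ and ξ = E₂ - κE₁, which is independent of (Z, E₁). Then R = (C - κA)Z + (B + κ)M
+ ξ, and the estimators come from two separate least squares problems, M on Z and R on (Z, M). This
gives the maximum likelihood claim (`logLik_eq_sub`), and the normal equation along Z shows that the
difference and product estimators coincide whenever Z ≠ 0 and Z, M are not collinear
(`differenceEst_eq_productEst`). For n ≥ 2 collinearity is null on Z ≠ 0 (`Model.ae_gram_ne_zero`),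
and P(Z = 0) → 0.

For the limit law, project E₁ on the direction of Z, and ξ on the direction of the part of E₁
orthogonal to Z. For every n ≥ 1 these scores G, H are exactly independent Gaussians with variances
σ₁² and σ₂²(1 - δ²) (`Model.hasLaw_scores`). The normalized error of the product is B·Gs + A·Ht +
GsHt/√n (`sqrt_mul_productEst_sub`), where s → 1/√q and t → 1/σ₁ in probability, so Slutsky's
theorem concludes. No central limit theorem is needed. -/

lemma tendstoInMeasure_prodMk {E F : Type*} [PseudoEMetricSpace E] [PseudoEMetricSpace F]
    {X : ℕ → Ω → E} {Y : ℕ → Ω → F} {c : Ω → E} {d : Ω → F}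
    (hX : TendstoInMeasure P X atTop c) (hY : TendstoInMeasure P Y atTop d) :
    TendstoInMeasure P (fun n ω => (X n ω, Y n ω)) atTop (fun ω => (c ω, d ω)) := by
  intro ε hε
  have h0 : Tendsto (fun n => P {ω | ε ≤ edist (X n ω) (c ω)} + P {ω | ε ≤ edist (Y n ω) (d ω)})
      atTop (𝓝 0) := by simpa using (hX ε hε).add (hY ε hε)
  refine tendsto_of_tendsto_of_tendsto_of_le_of_le tendsto_const_nhds h0 (fun _ => zero_le) ?_
  intro n
  refine (measure_mono ?_).trans (measure_union_le _ _)
  intro ω hω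
  simpa [Prod.edist_eq] using hω

lemma tendstoInMeasure_comp_continuousAt {E F : Type*} [PseudoEMetricSpace E]
    [PseudoEMetricSpace F] {X : ℕ → Ω → E} {c : E} {f : E → F} (hf : ContinuousAt f c)
    (hX : TendstoInMeasure P X atTop (fun _ => c)) :
    TendstoInMeasure P (fun n ω => f (X n ω)) atTop (fun _ => f c) := by
  intro ε hε
  obtain ⟨η, hη, h⟩ := EMetric.mem_nhds_iff.1 (EMetric.tendsto_nhds.1 hf ε hε)
  refine tendsto_of_tendsto_of_tendsto_of_le_of_le tendsto_const_nhds (hX η hη)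
    (fun _ => zero_le) ?_
  intro n
  refine measure_mono fun ω hω => ?_
  by_contra hlt
  have h1 : edist (f (X n ω)) (f c) < ε := h (Metric.mem_eball.2 (not_le.1 hlt))
  exact absurd h1 (not_lt.2 hω)

lemma tendstoInMeasure_sub_of_measure_ne {X Y : ℕ → Ω → ℝ}
    (h : Tendsto (fun n => P {ω | X n ω ≠ Y n ω}) atTop (𝓝 0)) :
    TendstoInMeasure P (X - Y) atTop 0 := by
  intro ε hε
  refine tendsto_of_tendsto_of_tendsto_of_le_of_le tendsto_const_nhds h (fun _ => zero_le) ?_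
  intro n
  refine measure_mono fun ω hω => ?_
  rintro heq
  simp only [Set.mem_ofPred_eq, Pi.sub_apply, heq, sub_self, Pi.zero_apply, edist_self] at hω
  exact absurd hε (not_lt.2 hω)

/-- Chebyshev's inequality. The mean is prescribed only eventually because averages over n = 0
observations take the default value 0. -/
lemma tendstoInMeasure_of_variance_tendsto_zero [IsFiniteMeasure P] {X : ℕ → Ω → ℝ} {c : ℝ}
    (hX : ∀ n, MemLp (X n) 2 P) (hc : ∀ᶠ n in atTop, ∫ ω, X n ω ∂P = c)
    (hv : Tendsto (fun n => Var[X n; P]) atTop (𝓝 0)) :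
    TendstoInMeasure P X atTop (fun _ => c) := by
  rw [tendstoInMeasure_iff_norm]
  intro ε hε
  have h0 : Tendsto (fun n => ENNReal.ofReal (Var[X n; P] / ε ^ 2)) atTop (𝓝 0) := by
    simpa using ENNReal.tendsto_ofReal (hv.div_const (ε ^ 2))
  refine tendsto_of_tendsto_of_tendsto_of_le_of_le' tendsto_const_nhds h0
    (Eventually.of_forall fun _ => zero_le) ?_
  filter_upwards [hc] with n hn
  have := meas_ge_le_variance_div_sq (hX n) hε
  rwa [hn] at this

lemma tendstoInDistribution_of_eventually_hasLaw [IsProbabilityMeasure P] {E : Type*}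
    [TopologicalSpace E] [MeasurableSpace E] [OpensMeasurableSpace E] {X : ℕ → Ω → E}
    {μ : Measure E} [IsProbabilityMeasure μ] (hX : ∀ n, AEMeasurable (X n) P)
    (h : ∀ᶠ n in atTop, HasLaw (X n) μ P) :
    TendstoInDistribution X atTop (id : E → E) (fun _ => P) μ where
  forall_aemeasurable := hX
  aemeasurable_limit := aemeasurable_id
  tendsto := by
    refine tendsto_const_nhds.congr' ?_
    filter_upwards [h] with n hn
    exact Subtype.ext (by simpa using hn.map_eq.symm)

end Convergence

/-! ### Independence through product laws -/

section Independence

variable {Ω α β γ : Type*} [MeasurableSpace Ω] [MeasurableSpace α] [MeasurableSpace β]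
  [MeasurableSpace γ] {P : Measure Ω} [IsProbabilityMeasure P]

/-- If the law of `f x Y` does not depend on `x`, then `f X Y` has this law and is independent of
`X`, for `X` independent of `Y`. -/
lemma indepFun_hasLaw_of_map_eq {X : Ω → α} {Y : Ω → β} (hX : AEMeasurable X P)
    (hY : AEMeasurable Y P) (hXY : IndepFun X Y P) {f : α → β → γ}
    (hf : Measurable (Function.uncurry f)) {ν : Measure γ} [IsProbabilityMeasure ν]
    (hν : ∀ x, HasLaw (fun ω => f x (Y ω)) ν P) :
    HasLaw (fun ω => f (X ω) (Y ω)) ν P ∧ IndepFun X (fun ω => f (X ω) (Y ω)) P := by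
  have := Measure.isProbabilityMeasure_map (μ := P) hX
  have := Measure.isProbabilityMeasure_map (μ := P) hY
  -- A skew product over the identity: each fibre map `f x` carries the law of `Y` to the same `ν`.
  have hmp : MeasurePreserving (fun p : α × β => (p.1, f p.1 p.2))
      ((P.map X).prod (P.map Y)) ((P.map X).prod ν) := by
    refine (MeasurePreserving.id (P.map X)).skew_product hf (ae_of_all _ fun x => ?_)
    have hfx : Measurable (f x) := hf.of_uncurry_left
    rw [AEMeasurable.map_map_of_aemeasurable hfx.aemeasurable hY]
    exact (hν x).map_eq
  have hlX : HasLaw X (P.map X) P := ⟨hX, rfl⟩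
  have hlY : HasLaw Y (P.map Y) P := ⟨hY, rfl⟩
  have hl := hmp.fun_comp_hasLaw ((indepFun_iff_hasLaw_prodMk_prod hlX hlY).1 hXY)
  have hf' : HasLaw (fun ω => f (X ω) (Y ω)) ν P := measurePreserving_snd.fun_comp_hasLaw hl
  exact ⟨hf', (indepFun_iff_hasLaw_prodMk_prod hlX hf').2 hl⟩

lemma indepFun_prodMk_of_indepFun {X : Ω → α} {Y : Ω → β} {Z : Ω → γ} (hX : AEMeasurable X P)
    (hY : AEMeasurable Y P) (hZ : AEMeasurable Z P) (h : IndepFun X (fun ω => (Y ω, Z ω)) P)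
    (hYZ : IndepFun Y Z P) : IndepFun (fun ω => (X ω, Y ω)) Z P := by
  have := Measure.isProbabilityMeasure_map (μ := P) hX
  have := Measure.isProbabilityMeasure_map (μ := P) hY
  have := Measure.isProbabilityMeasure_map (μ := P) hZ
  have hlX : HasLaw X (P.map X) P := ⟨hX, rfl⟩
  have hlY : HasLaw Y (P.map Y) P := ⟨hY, rfl⟩
  have hlZ : HasLaw Z (P.map Z) P := ⟨hZ, rfl⟩
  have hXY : IndepFun X Y P := h.comp measurable_id measurable_fst
  have h1 := (indepFun_iff_hasLaw_prodMk_prod hlX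
    ((indepFun_iff_hasLaw_prodMk_prod hlY hlZ).1 hYZ)).1 h
  refine (indepFun_iff_hasLaw_prodMk_prod ((indepFun_iff_hasLaw_prodMk_prod hlX hlY).1 hXY)
    hlZ).2 ?_
  exact (measurePreserving_prodAssoc (P.map X) (P.map Y) (P.map Z)).symm.fun_comp_hasLaw h1

end Independence

/-! ### Linear and quadratic forms in i.i.d. Gaussians -/

section Gaussian

variable {Ω ι : Type*} [MeasurableSpace Ω] [Fintype ι] {P : Measure Ω} [IsProbabilityMeasure P]

omit [IsProbabilityMeasure P] in
-- The law depends on `u` only through its norm, so a projection on an independent random unit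
-- direction has a fixed law.
lemma hasLaw_dotProduct_of_iIndepFun {X : Ω → ι → ℝ} {v : NNReal}
    (hX : ∀ i, HasLaw (fun ω => X ω i) (gaussianReal 0 v) P)
    (hind : iIndepFun (fun i ω => X ω i) P) (u : ι → ℝ) :
    HasLaw (fun ω => u ⬝ᵥ X ω) (gaussianReal 0 ((u ⬝ᵥ u).toNNReal * v)) P := by
  have hl (i : ι) := gaussianReal_const_mul (hX i) (u i)
  have hg (i : ι) : HasGaussianLaw (fun ω => u i * X ω i) P := (hl i).hasGaussianLaw
  have hi : iIndepFun (fun i ω => u i * X ω i) P :=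
    hind.comp (fun i x => u i * x) (fun i => measurable_const_mul _)
  have hs : HasGaussianLaw (fun ω => ∑ i, u i * X ω i) P :=
    iIndepFun.hasGaussianLaw_fun_sum hg hi
  refine ⟨hs.aemeasurable, ?_⟩
  change P.map (fun ω => ∑ i, u i * X ω i) = _
  rw [hs.map_eq_gaussianReal]
  have hm : ∫ ω, ∑ i, u i * X ω i ∂P = 0 := by
    rw [integral_finsetSum _ fun i _ => (hg i).integrable]
    refine Finset.sum_eq_zero fun i _ => ?_
    rw [(hl i).integral_eq, integral_id_gaussianReal, mul_zero]
  have hv : Var[fun ω => ∑ i, u i * X ω i; P] = (u ⬝ᵥ u) * v := by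
    have := IndepFun.variance_sum (μ := P) (s := Finset.univ) (X := fun i ω => u i * X ω i)
      (fun i _ => (hg i).memLp_two) (fun i _ j _ hij => hi.indepFun hij)
    rw [Finset.sum_fn] at this
    rw [this, dotProduct, Finset.sum_mul]
    refine Finset.sum_congr rfl fun i _ => ?_
    rw [(hl i).variance_eq, variance_id_gaussianReal]
    simp [sq]
  rw [hm, hv, Real.toNNReal_mul (by simpa using dotProduct_star_self_nonneg u)]
  simp

lemma variance_dotProduct_self {X : Ω → ι → ℝ} {v : NNReal}
    (hX : ∀ i, HasLaw (fun ω => X ω i) (gaussianReal 0 v) P)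
    (hind : iIndepFun (fun i ω => X ω i) P) :
    MemLp (fun ω => X ω ⬝ᵥ X ω) 2 P ∧ ∫ ω, X ω ⬝ᵥ X ω ∂P = Fintype.card ι * v ∧
      Var[fun ω => X ω ⬝ᵥ X ω; P] = Fintype.card ι * Var[fun x => x ^ 2; gaussianReal 0 v] := by
  have hg (i : ι) : HasGaussianLaw (fun ω => X ω i) P := (hX i).hasGaussianLaw
  -- Hölder with 1/4 + 1/4 = 1/2, as Gaussians have fourth moments.
  have hL (i : ι) : MemLp (fun ω => X ω i * X ω i) 2 P :=
    ((hg i).memLp (p := 4) (by norm_num)).mul' (hpqr := ⟨by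
      rw [← ENNReal.toReal_eq_toReal_iff' (by simp) (by simp)]
      rw [ENNReal.toReal_add (by simp) (by simp)]; norm_num⟩) ((hg i).memLp (p := 4) (by norm_num))
  refine ⟨memLp_finsetSum _ fun i _ => hL i, ?_, ?_⟩
  · simp only [dotProduct]
    rw [integral_finsetSum _ fun i _ => (hL i).integrable (by norm_num)]
    have (i : ι) : ∫ ω, X ω i * X ω i ∂P = v := by
      have hv := variance_eq_sub (hg i).memLp_two
      rw [(hX i).variance_eq, variance_id_gaussianReal, (hX i).integral_eq,
        integral_id_gaussianReal] at hv
      simpa [sq] using hv.symm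
    simp [this]
  · have hi : iIndepFun (fun i ω => X ω i * X ω i) P :=
      hind.comp (fun i x => x * x) (fun i => by fun_prop)
    have := IndepFun.variance_sum (μ := P) (s := Finset.univ) (X := fun i ω => X ω i * X ω i)
      (fun i _ => hL i) (fun i _ j _ hij => hi.indepFun hij)
    rw [Finset.sum_fn] at this
    simp only [dotProduct]
    rw [this]
    have (i : ι) : Var[fun ω => X ω i * X ω i; P] = Var[fun x => x ^ 2; gaussianReal 0 v] := by
      rw [← (hX i).map_eq, variance_map (by fun_prop) (hX i).aemeasurable]
      simp [Function.comp_def, sq]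
    simp [this]

end Gaussian

/-! ### Decorrelating the two errors -/

lemma posSemidef_errorCov {σ₁ σ₂ δ : ℝ} (hδ : δ ∈ Set.Ioo (-1 : ℝ) 1) :
    (errorCov σ₁ σ₂ δ).PosSemidef := by
  refine Matrix.PosSemidef.of_dotProduct_mulVec_nonneg ?_ fun x => ?_
  · ext i j
    fin_cases i <;> fin_cases j <;> simp [errorCov]
  · have h1 : 0 ≤ 1 - δ ^ 2 := by nlinarith [hδ.1, hδ.2]
    have h2 : star x ⬝ᵥ (errorCov σ₁ σ₂ δ *ᵥ x) =
        (σ₁ * x 0 + δ * σ₂ * x 1) ^ 2 + (1 - δ ^ 2) * (σ₂ * x 1) ^ 2 := by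
      simp [errorCov, dotProduct, mulVec, Fin.sum_univ_two]
      ring
    rw [h2]
    positivity

/-- The part of the outcome error that is uncorrelated with the mediator error. -/
noncomputable def residualError {n : ℕ} (σ₁ σ₂ δ : ℝ) (E₁ E₂ : Fin n → ℝ) : Fin n → ℝ :=
  fun i => E₂ i - δ * σ₂ / σ₁ * E₁ i

section Law

variable {Ω : Type*} [MeasurableSpace Ω] {P : Measure Ω}
  {A B C σ₁ σ₂ δ : ℝ} {n : ℕ} {Z M R E₁ E₂ : Ω → Fin n → ℝ}

lemma Model.covariance_errors (h : Model P A B C σ₁ σ₂ δ Z M R E₁ E₂)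
    (hδ : δ ∈ Set.Ioo (-1 : ℝ) 1) (a b : Fin 2) (i j : Fin n) :
    cov[fun ω => cols (E₁ ω) (E₂ ω) i a, fun ω => cols (E₁ ω) (E₂ ω) j b; P] =
      errorCov σ₁ σ₂ δ a b * (1 : Matrix (Fin n) (Fin n) ℝ) i j := by
  have hS := (posSemidef_errorCov (σ₁ := σ₁) (σ₂ := σ₂) hδ).kronecker
    (Matrix.PosSemidef.one (n := Fin n) (R := ℝ))
  -- `Matrix.vec` puts the entry in row `i` and column `a` at index `(a, i)`, which matches the
  -- order of the Kronecker factors.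
  have := h.errors_law.covariance_fun_comp (f := fun x => x (a, i)) (g := fun x => x (b, j))
    (by fun_prop) (by fun_prop)
  rw [covariance_eval_multivariateGaussian hS] at this
  exact this

/-- Joint Gaussianity is what turns zero covariance into independence. -/
lemma Model.hasGaussianLaw_errors (h : Model P A B C σ₁ σ₂ δ Z M R E₁ E₂) :
    HasGaussianLaw (fun ω => (fun i => E₁ ω i, fun i => residualError σ₁ σ₂ δ (E₁ ω) (E₂ ω) i))
      P := by
  let L : EuclideanSpace ℝ (Fin 2 × Fin n) →L[ℝ] (Fin n → ℝ) × (Fin n → ℝ) :=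
    (ContinuousLinearMap.pi fun i => EuclideanSpace.proj (0, i)).prod
      (ContinuousLinearMap.pi fun i =>
        EuclideanSpace.proj (1, i) - (δ * σ₂ / σ₁) • EuclideanSpace.proj (0, i))
  exact h.errors_law.hasGaussianLaw.map_fun L

lemma Model.hasGaussianLaw_error_apply (h : Model P A B C σ₁ σ₂ δ Z M R E₁ E₂) (a : Fin 2)
    (i : Fin n) : HasGaussianLaw (fun ω => cols (E₁ ω) (E₂ ω) i a) P :=
  h.errors_law.hasGaussianLaw.map_fun
    (EuclideanSpace.proj (a, i) : EuclideanSpace ℝ (Fin 2 × Fin n) →L[ℝ] ℝ)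

lemma Model.indepFun_treatment_error (h : Model P A B C σ₁ σ₂ δ Z M R E₁ E₂) :
    IndepFun Z E₁ P :=
  h.indep.comp measurable_id measurable_fst

lemma Model.integral_errors (h : Model P A B C σ₁ σ₂ δ Z M R E₁ E₂) (a : Fin 2) (i : Fin n) :
    ∫ ω, cols (E₁ ω) (E₂ ω) i a ∂P = 0 := by
  have h1 := (EuclideanSpace.proj (a, i) :
    EuclideanSpace ℝ (Fin 2 × Fin n) →L[ℝ] ℝ).integral_comp_comm
      h.errors_law.hasGaussianLaw.integrable
  rw [h.errors_law.integral_eq, integral_id_multivariateGaussian] at h1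
  simpa using h1

lemma Model.aemeasurable_error (h : Model P A B C σ₁ σ₂ δ Z M R E₁ E₂) : AEMeasurable E₁ P :=
  h.hasGaussianLaw_errors.fst.aemeasurable

lemma Model.aemeasurable_residualError (h : Model P A B C σ₁ σ₂ δ Z M R E₁ E₂) :
    AEMeasurable (fun ω => residualError σ₁ σ₂ δ (E₁ ω) (E₂ ω)) P :=
  h.hasGaussianLaw_errors.snd.aemeasurable

variable [IsProbabilityMeasure P]

lemma Model.covariance_residualError (h : Model P A B C σ₁ σ₂ δ Z M R E₁ E₂) (hσ₁ : 0 < σ₁)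
    (hδ : δ ∈ Set.Ioo (-1 : ℝ) 1) (i j : Fin n) :
    cov[fun ω => E₁ ω i, fun ω => E₁ ω j; P] =
        σ₁ ^ 2 * (1 : Matrix (Fin n) (Fin n) ℝ) i j ∧
      cov[fun ω => E₁ ω i, fun ω => residualError σ₁ σ₂ δ (E₁ ω) (E₂ ω) j; P] = 0 ∧
      cov[fun ω => residualError σ₁ σ₂ δ (E₁ ω) (E₂ ω) i,
          fun ω => residualError σ₁ σ₂ δ (E₁ ω) (E₂ ω) j; P] =
        σ₂ ^ 2 * (1 - δ ^ 2) * (1 : Matrix (Fin n) (Fin n) ℝ) i j := by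
  have hL (a : Fin 2) (k : Fin n) : MemLp (fun ω => cols (E₁ ω) (E₂ ω) k a) 2 P :=
    (h.hasGaussianLaw_error_apply a k).memLp_two
  have h1 (k : Fin n) : MemLp (fun ω => E₁ ω k) 2 P := hL 0 k
  have h2 (k : Fin n) : MemLp (fun ω => E₂ ω k) 2 P := hL 1 k
  have h3 (k : Fin n) : MemLp (fun ω => δ * σ₂ / σ₁ * E₁ ω k) 2 P := (h1 k).const_mul _
  have c00 := h.covariance_errors hδ 0 0 i j
  have c01 := h.covariance_errors hδ 0 1 i j
  have c10 := h.covariance_errors hδ 1 0 i j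
  have c11 := h.covariance_errors hδ 1 1 i j
  simp only [cols, errorCov, of_apply, cons_val_zero, cons_val_one, cons_val', cons_val_fin_one]
    at c00 c01 c10 c11
  refine ⟨c00, ?_, ?_⟩
  · simp only [residualError]
    rw [covariance_fun_sub_right (h1 i) (h2 j) (h3 j), covariance_const_mul_right, c00, c01]
    field_simp
    ring
  · simp only [residualError]
    rw [covariance_fun_sub_fun_sub (h2 i) (h3 i) (h2 j) (h3 j), covariance_const_mul_right,
      covariance_const_mul_left, covariance_const_mul_left, covariance_const_mul_right, c00, c01,
      c10, c11]
    field_simp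
    ring

lemma Model.indepFun_residualError (h : Model P A B C σ₁ σ₂ δ Z M R E₁ E₂) (hσ₁ : 0 < σ₁)
    (hδ : δ ∈ Set.Ioo (-1 : ℝ) 1) :
    IndepFun E₁ (fun ω => residualError σ₁ σ₂ δ (E₁ ω) (E₂ ω)) P :=
  h.hasGaussianLaw_errors.indepFun_of_covariance_eval
    (fun i j => (h.covariance_residualError hσ₁ hδ i j).2.1)

/-- Needed because the direction on which the residual error is projected is a function of both `Z`
and `E₁`. -/
lemma Model.indepFun_prodMk_residualError (h : Model P A B C σ₁ σ₂ δ Z M R E₁ E₂) (hσ₁ : 0 < σ₁)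
    (hδ : δ ∈ Set.Ioo (-1 : ℝ) 1) :
    IndepFun (fun ω => (Z ω, E₁ ω)) (fun ω => residualError σ₁ σ₂ δ (E₁ ω) (E₂ ω)) P := by
  refine indepFun_prodMk_of_indepFun h.aemeasurable_treatment h.aemeasurable_error
    h.aemeasurable_residualError ?_ (h.indepFun_residualError hσ₁ hδ)
  refine h.indep.comp (ψ := fun e : (Fin n → ℝ) × (Fin n → ℝ) =>
    (e.1, residualError σ₁ σ₂ δ e.1 e.2)) measurable_id ?_
  unfold residualError
  fun_prop

lemma Model.iid_error (h : Model P A B C σ₁ σ₂ δ Z M R E₁ E₂) (hσ₁ : 0 < σ₁)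
    (hδ : δ ∈ Set.Ioo (-1 : ℝ) 1) :
    (∀ i, HasLaw (fun ω => E₁ ω i) (gaussianReal 0 (σ₁ ^ 2).toNNReal) P) ∧
      iIndepFun (fun i ω => E₁ ω i) P := by
  have hg : HasGaussianLaw (fun ω i => E₁ ω i) P := h.hasGaussianLaw_errors.fst
  refine ⟨fun i => ⟨(hg.eval i).aemeasurable, ?_⟩, hg.iIndepFun_of_covariance_eq_zero
    fun i j hij => ?_⟩
  · rw [(hg.eval i).map_eq_gaussianReal, ← covariance_self (hg.eval i).aemeasurable,
      (h.covariance_residualError hσ₁ hδ i i).1, one_apply_eq, mul_one]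
    congr 1
    exact h.integral_errors 0 i
  · rw [(h.covariance_residualError hσ₁ hδ i j).1, one_apply_ne hij, mul_zero]

lemma Model.iid_residualError (h : Model P A B C σ₁ σ₂ δ Z M R E₁ E₂) (hσ₁ : 0 < σ₁)
    (hδ : δ ∈ Set.Ioo (-1 : ℝ) 1) :
    (∀ i, HasLaw (fun ω => residualError σ₁ σ₂ δ (E₁ ω) (E₂ ω) i)
        (gaussianReal 0 (σ₂ ^ 2 * (1 - δ ^ 2)).toNNReal) P) ∧
      iIndepFun (fun i ω => residualError σ₁ σ₂ δ (E₁ ω) (E₂ ω) i) P := by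
  have hg : HasGaussianLaw (fun ω i => residualError σ₁ σ₂ δ (E₁ ω) (E₂ ω) i) P :=
    h.hasGaussianLaw_errors.snd
  have hI (a : Fin 2) (k : Fin n) : Integrable (fun ω => cols (E₁ ω) (E₂ ω) k a) P :=
    (h.hasGaussianLaw_error_apply a k).integrable
  refine ⟨fun i => ⟨(hg.eval i).aemeasurable, ?_⟩, hg.iIndepFun_of_covariance_eq_zero
    fun i j hij => ?_⟩
  · rw [(hg.eval i).map_eq_gaussianReal, ← covariance_self (hg.eval i).aemeasurable,
      (h.covariance_residualError hσ₁ hδ i i).2.2, one_apply_eq, mul_one]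
    congr 1
    have h0 : ∫ ω, E₁ ω i ∂P = 0 := h.integral_errors 0 i
    have h1 : ∫ ω, E₂ ω i ∂P = 0 := h.integral_errors 1 i
    simp only [residualError]
    have hI1 : Integrable (fun ω => E₁ ω i) P := hI 0 i
    have hI2 : Integrable (fun ω => E₂ ω i) P := hI 1 i
    rw [integral_sub hI2 (hI1.const_mul _), integral_const_mul, h0, h1]
    simp
  · rw [(h.covariance_residualError hσ₁ hδ i j).2.2, one_apply_ne hij, mul_zero]

end Law

/-! ### Exact algebra of the estimators and of the likelihood -/

section Algebra

variable {n : ℕ}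

/-- The Gram determinant of two vectors. -/
noncomputable def gram (z m : Fin n → ℝ) : ℝ := (z ⬝ᵥ z) * (m ⬝ᵥ m) - (z ⬝ᵥ m) ^ 2

/-- A shear preserves the determinant, so collinearity of treatment and mediator is a question about
treatment and error. -/
lemma gram_smul_add (z e : Fin n → ℝ) (A : ℝ) : gram z (A • z + e) = gram z e := by
  simp only [gram, dotProduct_add, add_dotProduct, smul_dotProduct, dotProduct_smul, smul_eq_mul,
    dotProduct_comm e z]
  ring

lemma dotProduct_self_nonneg' (z : Fin n → ℝ) : 0 ≤ z ⬝ᵥ z := by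
  simpa using dotProduct_star_self_nonneg z

lemma dotProduct_self_pos' {z : Fin n → ℝ} (hz : z ≠ 0) : 0 < z ⬝ᵥ z :=
  (dotProduct_self_nonneg' z).lt_of_ne' (by simpa using hz)

/-- `z ⬝ᵥ z` times the component of `e` orthogonal to `z`. -/
noncomputable def orthPart (z e : Fin n → ℝ) : Fin n → ℝ := (z ⬝ᵥ z) • e - (z ⬝ᵥ e) • z

lemma orthPart_dotProduct_self (z e : Fin n → ℝ) :
    orthPart z e ⬝ᵥ orthPart z e = (z ⬝ᵥ z) * gram z e := by
  simp only [orthPart, gram, dotProduct_sub, sub_dotProduct, smul_dotProduct, dotProduct_smul,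
    smul_eq_mul, dotProduct_comm e z]
  ring

lemma gram_nonneg (z e : Fin n → ℝ) : 0 ≤ gram z e := by
  by_cases hz : z = 0
  · simp [gram, hz]
  · have h := dotProduct_self_nonneg' (orthPart z e)
    rw [orthPart_dotProduct_self] at h
    exact nonneg_of_mul_nonneg_right h (dotProduct_self_pos' hz)

variable {σ₁ σ₂ δ A B C : ℝ} {Z M R E₁ E₂ : Fin n → ℝ}

lemma hatA_sub (hM : M = A • Z + E₁) (hZ : Z ≠ 0) :
    hatA Z M - A = (Z ⬝ᵥ E₁) / (Z ⬝ᵥ Z) := by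
  have := (dotProduct_self_pos' hZ).ne'
  rw [hatA, hM, dotProduct_add, dotProduct_smul, smul_eq_mul]
  field_simp
  ring

/-- The least squares coefficient of `M` estimates B + δσ₂/σ₁, since `E₂` contains (δσ₂/σ₁)`E₁`; the
correction in `hatB` removes exactly this bias and leaves the residual error. -/
lemma hatB_sub (hM : M = A • Z + E₁) (hR : R = C • Z + B • M + E₂) (hD : gram Z E₁ ≠ 0) :
    hatB σ₁ σ₂ δ Z M R - B =
      (orthPart Z E₁ ⬝ᵥ residualError σ₁ σ₂ δ E₁ E₂) / gram Z E₁ := by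
  have hE : E₂ = residualError σ₁ σ₂ δ E₁ E₂ + (δ * σ₂ / σ₁) • E₁ := by
    ext i; simp [residualError]
  generalize residualError σ₁ σ₂ δ E₁ E₂ = ξ at *
  have hden : (Z ⬝ᵥ Z) * (M ⬝ᵥ M) - (M ⬝ᵥ Z) * (Z ⬝ᵥ M) = gram Z E₁ := by
    rw [← gram_smul_add Z E₁ A, ← hM, gram, dotProduct_comm M Z, sq]
  rw [hatB, hden, eq_div_iff hD, sub_mul, sub_mul, div_mul_cancel₀ _ hD]
  subst hE hR hM
  simp only [orthPart, gram, dotProduct_add, add_dotProduct, sub_dotProduct, smul_dotProduct,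
    dotProduct_smul, smul_eq_mul, dotProduct_comm E₁ Z]
  ring

/-- Let c, b be the least squares coefficients of `R` on `Z` and `M`, and κ = δσ₂/σ₁. The normal
equation along `Z` reads `hatC'` = c + b·`hatA`, while `hatC` = c + κ·`hatA` and `hatB` = b - κ. -/
lemma differenceEst_eq_productEst (hσ₁ : σ₁ ≠ 0) (hZ : Z ≠ 0) (hD : gram Z M ≠ 0) :
    differenceEst σ₁ σ₂ δ Z M R = productEst σ₁ σ₂ δ Z M R := by
  have hz := (dotProduct_self_pos' hZ).ne'
  have hden : (Z ⬝ᵥ Z) * (M ⬝ᵥ M) - (M ⬝ᵥ Z) * (Z ⬝ᵥ M) = gram Z M := by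
    rw [gram, dotProduct_comm M Z, sq]
  rw [differenceEst, productEst, hatC', hatC, hatA, hatB, hden, dotProduct_comm M Z]
  field_simp
  rw [gram]
  ring

lemma trace_residual (S : Matrix (Fin 2) (Fin 2) ℝ) (r s : Fin n → ℝ) :
    (cols r s * S * (cols r s)ᵀ).trace =
      S 0 0 * (r ⬝ᵥ r) + (S 0 1 + S 1 0) * (r ⬝ᵥ s) + S 1 1 * (s ⬝ᵥ s) := by
  simp only [trace, diag_apply, mul_apply, transpose_apply, cols, of_apply, Fin.sum_univ_two,
    cons_val_zero, cons_val_one, dotProduct, Finset.mul_sum, ← Finset.sum_add_distrib]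
  refine Finset.sum_congr rfl fun i _ => ?_
  ring

lemma cols_sub_cols_mul {Θ : Matrix (Fin 2) (Fin 2) ℝ} (hΘ : Θ 1 0 = 0) :
    cols M R - cols Z M * Θ = cols (M - Θ 0 0 • Z) (R - Θ 0 1 • Z - Θ 1 1 • M) := by
  ext i j
  fin_cases j <;> simp [cols, mul_apply, Fin.sum_univ_two, hΘ] <;> ring

lemma inv_errorCov (hσ₁ : σ₁ ≠ 0) (hσ₂ : σ₂ ≠ 0) (hδ : 1 - δ ^ 2 ≠ 0) :
    (errorCov σ₁ σ₂ δ)⁻¹ = !![1 / (σ₁ ^ 2 * (1 - δ ^ 2)), -δ / (σ₁ * σ₂ * (1 - δ ^ 2));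
      -δ / (σ₁ * σ₂ * (1 - δ ^ 2)), 1 / (σ₂ ^ 2 * (1 - δ ^ 2))] := by
  refine inv_eq_right_inv ?_
  ext i j
  fin_cases i <;> fin_cases j <;> simp [errorCov, mul_apply, Fin.sum_univ_two] <;> field_simp <;>
    ring

/-- The log-likelihood is its value at the closed-form estimators minus a sum of squares. -/
lemma logLik_eq_sub (hσ₁ : σ₁ ≠ 0) (hσ₂ : σ₂ ≠ 0) (hδ : 1 - δ ^ 2 ≠ 0) (hZ : Z ≠ 0)
    (hD : gram Z M ≠ 0) {Θ : Matrix (Fin 2) (Fin 2) ℝ} (hΘ : Θ 1 0 = 0) :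
    logLik (cols M R) (cols Z M) Θ (errorCov σ₁ σ₂ δ) =
      logLik (cols M R) (cols Z M) !![hatA Z M, hatC σ₁ σ₂ δ Z M R; 0, hatB σ₁ σ₂ δ Z M R]
          (errorCov σ₁ σ₂ δ) -
        ((Θ 0 0 - hatA Z M) ^ 2 * (Z ⬝ᵥ Z) / σ₁ ^ 2 +
          (((Θ 0 1 - hatC σ₁ σ₂ δ Z M R - δ * σ₂ / σ₁ * (Θ 0 0 - hatA Z M)) * (Z ⬝ᵥ Z) +
              (Θ 1 1 - hatB σ₁ σ₂ δ Z M R) * (Z ⬝ᵥ M)) ^ 2 +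
            (Θ 1 1 - hatB σ₁ σ₂ δ Z M R) ^ 2 * gram Z M) /
            ((Z ⬝ᵥ Z) * (σ₂ ^ 2 * (1 - δ ^ 2)))) := by
  have hz := (dotProduct_self_pos' hZ).ne'
  have hden : (Z ⬝ᵥ Z) * (M ⬝ᵥ M) - (M ⬝ᵥ Z) * (Z ⬝ᵥ M) = gram Z M := by
    rw [gram, dotProduct_comm M Z, sq]
  have ha : hatA Z M * (Z ⬝ᵥ Z) = Z ⬝ᵥ M := by rw [hatA]; field_simp
  -- the normal equations of the regression of `R` on `Z` and `M`
  have hn1 : (hatC σ₁ σ₂ δ Z M R - δ * σ₂ / σ₁ * hatA Z M) * (Z ⬝ᵥ Z) +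
      (hatB σ₁ σ₂ δ Z M R + δ * σ₂ / σ₁) * (Z ⬝ᵥ M) = Z ⬝ᵥ R := by
    rw [hatC, hatB, hatA, hden, dotProduct_comm M Z]
    field_simp
    rw [gram]
    ring
  have hn2 : (hatC σ₁ σ₂ δ Z M R - δ * σ₂ / σ₁ * hatA Z M) * (Z ⬝ᵥ M) +
      (hatB σ₁ σ₂ δ Z M R + δ * σ₂ / σ₁) * (M ⬝ᵥ M) = M ⬝ᵥ R := by
    rw [hatC, hatB, hatA, hden, dotProduct_comm M Z]
    field_simp
    rw [gram]
    ring
  -- With m = M - aZ, r = R - cZ - bM and κ = δσ₂/σ₁, the quadratic form is |m|²/σ₁² + |r -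
  -- κm|²/(σ₂²(1 - δ²)), and r - κm = R - (c - κa)Z - (b + κ)M. The normal equations now carry all
  -- that is needed about the estimators, and a rational identity remains.
  generalize hatA Z M = a at *
  generalize hatB σ₁ σ₂ δ Z M R = b at *
  generalize hatC σ₁ σ₂ δ Z M R = c at *
  have hΘ' : (!![a, c; 0, b] : Matrix (Fin 2) (Fin 2) ℝ) 1 0 = 0 := by simp
  rw [logLik, logLik, cols_sub_cols_mul hΘ, cols_sub_cols_mul hΘ', trace_residual, trace_residual,
    inv_errorCov hσ₁ hσ₂ hδ]
  simp only [of_apply, cons_val_zero, cons_val_one, cons_val', cons_val_fin_one, dotProduct_sub,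
    sub_dotProduct, smul_dotProduct, dotProduct_smul, smul_eq_mul, dotProduct_comm M Z,
    dotProduct_comm R Z, dotProduct_comm R M, ← hn1, ← hn2, gram]
  generalize Z ⬝ᵥ M = zm at *
  subst ha
  field_simp
  ring

lemma isConstrainedMLE_iff (hσ₁ : σ₁ ≠ 0) (hσ₂ : σ₂ ≠ 0) (hδ : δ ∈ Set.Ioo (-1 : ℝ) 1)
    (hZ : Z ≠ 0) (hD : gram Z M ≠ 0) (Θ : Matrix (Fin 2) (Fin 2) ℝ) :
    IsConstrainedMLE (errorCov σ₁ σ₂ δ) Z M R Θ ↔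
      Θ = !![hatA Z M, hatC σ₁ σ₂ δ Z M R; 0, hatB σ₁ σ₂ δ Z M R] := by
  have h1 : 0 < 1 - δ ^ 2 := by nlinarith [hδ.1, hδ.2]
  have hz := dotProduct_self_pos' hZ
  have hg : 0 < gram Z M := (gram_nonneg Z M).lt_of_ne' hD
  have key := fun {Θ' : Matrix (Fin 2) (Fin 2) ℝ} (h : Θ' 1 0 = 0) =>
    logLik_eq_sub (R := R) hσ₁ hσ₂ h1.ne' hZ hD h
  constructor
  · rintro ⟨h0, hmax⟩
    have h2 := hmax !![hatA Z M, hatC σ₁ σ₂ δ Z M R; 0, hatB σ₁ σ₂ δ Z M R] (by simp)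
    rw [key h0] at h2
    set p := (Θ 0 0 - hatA Z M) ^ 2 * (Z ⬝ᵥ Z) / σ₁ ^ 2 with hp
    set r := (Θ 0 1 - hatC σ₁ σ₂ δ Z M R - δ * σ₂ / σ₁ * (Θ 0 0 - hatA Z M)) * (Z ⬝ᵥ Z) +
      (Θ 1 1 - hatB σ₁ σ₂ δ Z M R) * (Z ⬝ᵥ M) with hr
    set s := (Θ 1 1 - hatB σ₁ σ₂ δ Z M R) ^ 2 * gram Z M with hs
    have hp0 : 0 ≤ p := by positivity
    have hs0 : 0 ≤ s := by positivity
    have hden : 0 < (Z ⬝ᵥ Z) * (σ₂ ^ 2 * (1 - δ ^ 2)) := by positivity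
    have hq0 : 0 ≤ (r ^ 2 + s) / ((Z ⬝ᵥ Z) * (σ₂ ^ 2 * (1 - δ ^ 2))) := by positivity
    have hpz : p = 0 := by linarith
    have hqz : (r ^ 2 + s) / ((Z ⬝ᵥ Z) * (σ₂ ^ 2 * (1 - δ ^ 2))) = 0 := by linarith
    have hrs : r ^ 2 + s = 0 := by simpa [hden.ne'] using hqz
    have hr0 : r ^ 2 = 0 := by nlinarith [sq_nonneg r]
    have hsz : s = 0 := by nlinarith [sq_nonneg r]
    -- The squares are triangular: once the diagonal differences vanish, `r` reduces to the
    -- remaining difference times `Z ⬝ᵥ Z`.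
    have e00 : Θ 0 0 - hatA Z M = 0 := by
      simpa [hp, hz.ne', hσ₁] using hpz
    have e11 : Θ 1 1 - hatB σ₁ σ₂ δ Z M R = 0 := by
      simpa [hs, hD] using hsz
    have e01 : Θ 0 1 - hatC σ₁ σ₂ δ Z M R = 0 := by
      simpa [hr, e00, e11, hz.ne'] using hr0
    ext i j
    fin_cases i <;> fin_cases j <;> simp [h0] <;> linarith
  · rintro rfl
    refine ⟨by simp, fun Θ' h' => ?_⟩
    rw [key h']
    have : 0 ≤ (Θ' 0 0 - hatA Z M) ^ 2 * (Z ⬝ᵥ Z) / σ₁ ^ 2 +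
          (((Θ' 0 1 - hatC σ₁ σ₂ δ Z M R - δ * σ₂ / σ₁ * (Θ' 0 0 - hatA Z M)) * (Z ⬝ᵥ Z) +
              (Θ' 1 1 - hatB σ₁ σ₂ δ Z M R) * (Z ⬝ᵥ M)) ^ 2 +
            (Θ' 1 1 - hatB σ₁ σ₂ δ Z M R) ^ 2 * gram Z M) /
            ((Z ⬝ᵥ Z) * (σ₂ ^ 2 * (1 - δ ^ 2))) := by positivity
    linarith

end Algebra

/-! ### Unit directions, scores and the expansion of the error -/

section UnitVector

variable {n : ℕ}

/-- The normalization of a vector, with the first basis vector as its value at zero. -/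
noncomputable def unitVec (x : Fin n → ℝ) : Fin n → ℝ :=
  open Classical in if x = 0 then fun i => if (i : ℕ) = 0 then 1 else 0 else (√(x ⬝ᵥ x))⁻¹ • x

lemma unitVec_of_ne_zero {x : Fin n → ℝ} (hx : x ≠ 0) : unitVec x = (√(x ⬝ᵥ x))⁻¹ • x :=
  if_neg hx

/-- The value chosen at zero removes every exception, so the scores have exact Gaussian laws even
where the treatment vanishes. -/
lemma unitVec_dotProduct_self (hn : 0 < n) (x : Fin n → ℝ) : unitVec x ⬝ᵥ unitVec x = 1 := by
  by_cases hx : x = 0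
  · obtain ⟨m, rfl⟩ := Nat.exists_eq_succ_of_ne_zero hn.ne'
    simp [unitVec, hx, dotProduct]
  · have h := dotProduct_self_pos' hx
    have h' := Real.mul_self_sqrt h.le
    have h'' := (Real.sqrt_pos.2 h).ne'
    rw [unitVec_of_ne_zero hx, smul_dotProduct, dotProduct_smul, smul_eq_mul, smul_eq_mul]
    nth_rewrite 3 [← h']
    field_simp

@[fun_prop]
lemma measurable_dotProduct {α : Type*} [MeasurableSpace α] {f g : α → Fin n → ℝ}
    (hf : Measurable f) (hg : Measurable g) : Measurable (fun x => f x ⬝ᵥ g x) := by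
  unfold dotProduct
  fun_prop

@[fun_prop]
lemma aemeasurable_dotProduct {α : Type*} [MeasurableSpace α] {μ : Measure α}
    {f g : α → Fin n → ℝ} (hf : AEMeasurable f μ) (hg : AEMeasurable g μ) :
    AEMeasurable (fun x => f x ⬝ᵥ g x) μ := by
  unfold dotProduct
  fun_prop

@[fun_prop]
lemma measurable_unitVec : Measurable (unitVec (n := n)) := by
  unfold unitVec
  exact Measurable.ite (measurableSet_singleton 0) measurable_const (by fun_prop)

@[fun_prop]
lemma measurable_orthPart :
    Measurable (fun p : (Fin n → ℝ) × (Fin n → ℝ) => orthPart p.1 p.2) := by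
  unfold orthPart
  fun_prop

/-- The projection of the mediator error on the direction of the treatment. -/
noncomputable def mediatorScore (z e : Fin n → ℝ) : ℝ := unitVec z ⬝ᵥ e

/-- The projection of the residual outcome error on the direction of the part of the mediator
that is orthogonal to the treatment. -/
noncomputable def outcomeScore (z e x : Fin n → ℝ) : ℝ := unitVec (orthPart z e) ⬝ᵥ x

lemma mediatorScore_eq {z : Fin n → ℝ} (hz : z ≠ 0) (e : Fin n → ℝ) :
    mediatorScore z e = (z ⬝ᵥ e) / √(z ⬝ᵥ z) := by
  rw [mediatorScore, unitVec_of_ne_zero hz, smul_dotProduct, smul_eq_mul, inv_mul_eq_div]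

lemma gram_eq_mul {z : Fin n → ℝ} (hz : z ≠ 0) (e : Fin n → ℝ) :
    gram z e = (z ⬝ᵥ z) * (e ⬝ᵥ e - mediatorScore z e ^ 2) := by
  have h := dotProduct_self_pos' hz
  rw [mediatorScore_eq hz, div_pow, Real.sq_sqrt h.le, gram]
  field_simp

lemma outcomeScore_eq {z e : Fin n → ℝ} (hz : z ≠ 0) (hg : gram z e ≠ 0) (x : Fin n → ℝ) :
    outcomeScore z e x = (orthPart z e ⬝ᵥ x) / √((z ⬝ᵥ z) * gram z e) := by
  have h : orthPart z e ≠ 0 := by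
    intro h0
    have := orthPart_dotProduct_self z e
    rw [h0, zero_dotProduct, zero_eq_mul] at this
    exact this.elim (dotProduct_self_pos' hz).ne' hg
  rw [outcomeScore, unitVec_of_ne_zero h, smul_dotProduct, smul_eq_mul, inv_mul_eq_div,
    orthPart_dotProduct_self]

/-- The normalized error of the product estimator, as a function of the two scores, of their
coefficients and of the inverse of the rate. -/
def expansion (B A : ℝ) (p : (ℝ × ℝ) × ((ℝ × ℝ) × ℝ)) : ℝ :=
  B * (p.1.1 * p.2.1.1) + A * (p.1.2 * p.2.1.2) + p.1.1 * p.2.1.1 * (p.1.2 * p.2.1.2) * p.2.2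

lemma continuous_expansion (B A : ℝ) : Continuous (expansion B A) := by
  unfold expansion
  fun_prop

variable {σ₁ σ₂ δ A B C : ℝ} {Z M R E₁ E₂ : Fin n → ℝ}

/-- Expand ab - AB = B(a - A) + A(b - B) + (a - A)(b - B) and scale each difference by √n. The
quantity inverted under the second root is the mean square of `E₁` after removal of its component
along `Z`. -/
lemma sqrt_mul_productEst_sub (hn : 0 < n) (hM : M = A • Z + E₁) (hR : R = C • Z + B • M + E₂)
    (hZ : Z ≠ 0) (hD : gram Z E₁ ≠ 0) :
    √(n : ℝ) * (productEst σ₁ σ₂ δ Z M R - A * B) =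
      expansion B A
        ((mediatorScore Z E₁, outcomeScore Z E₁ (residualError σ₁ σ₂ δ E₁ E₂)),
          ((√((Z ⬝ᵥ Z) / n)⁻¹,
            √((E₁ ⬝ᵥ E₁) / n - (mediatorScore Z E₁ / √(n : ℝ)) ^ 2)⁻¹), (√(n : ℝ))⁻¹)) := by
  have hn' : (0 : ℝ) < n := by exact_mod_cast hn
  have hz := dotProduct_self_pos' hZ
  have hg : 0 < gram Z E₁ := (gram_nonneg Z E₁).lt_of_ne' hD
  have hA : √(n : ℝ) * (hatA Z M - A) = mediatorScore Z E₁ * √((Z ⬝ᵥ Z) / n)⁻¹ := by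
    rw [hatA_sub hM hZ, mediatorScore_eq hZ, inv_div, Real.sqrt_div hn'.le]
    nth_rewrite 1 [← Real.mul_self_sqrt hz.le]
    have := (Real.sqrt_pos.2 hz).ne'
    field_simp
  have hB : √(n : ℝ) * (hatB σ₁ σ₂ δ Z M R - B) =
      outcomeScore Z E₁ (residualError σ₁ σ₂ δ E₁ E₂) *
        √((E₁ ⬝ᵥ E₁) / n - (mediatorScore Z E₁ / √(n : ℝ)) ^ 2)⁻¹ := by
    have h1 : (E₁ ⬝ᵥ E₁) / n - (mediatorScore Z E₁ / √(n : ℝ)) ^ 2 =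
        gram Z E₁ / (n * (Z ⬝ᵥ Z)) := by
      rw [gram_eq_mul hZ, div_pow, Real.sq_sqrt hn'.le]
      field_simp
    rw [h1, hatB_sub hM hR hD, outcomeScore_eq hZ hD, inv_div, Real.sqrt_div (by positivity),
      Real.sqrt_mul hn'.le, Real.sqrt_mul hz.le]
    nth_rewrite 1 [← Real.mul_self_sqrt hg.le]
    have := (Real.sqrt_pos.2 hz).ne'
    have := (Real.sqrt_pos.2 hg).ne'
    field_simp
  have hs := (Real.sqrt_pos.2 hn').ne'
  rw [expansion, productEst]
  dsimp only
  rw [← hA, ← hB]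
  field_simp
  ring

end UnitVector

/-! ### Joint law of the scores and almost sure non-collinearity -/

section Scores

variable {Ω : Type*} [MeasurableSpace Ω] {P : Measure Ω} [IsProbabilityMeasure P]
  {A B C σ₁ σ₂ δ : ℝ} {n : ℕ} {Z M R E₁ E₂ : Ω → Fin n → ℝ}

lemma Model.hasLaw_mediatorScore (h : Model P A B C σ₁ σ₂ δ Z M R E₁ E₂) (hσ₁ : 0 < σ₁)
    (hδ : δ ∈ Set.Ioo (-1 : ℝ) 1) (hn : 0 < n) :
    HasLaw (fun ω => mediatorScore (Z ω) (E₁ ω)) (gaussianReal 0 (σ₁ ^ 2).toNNReal) P := by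
  obtain ⟨hl, hi⟩ := h.iid_error hσ₁ hδ
  refine (indepFun_hasLaw_of_map_eq h.aemeasurable_treatment h.aemeasurable_error
    h.indepFun_treatment_error (f := mediatorScore) ?_ fun z => ?_).1
  · unfold mediatorScore Function.uncurry
    fun_prop
  · simpa [mediatorScore, unitVec_dotProduct_self hn] using
      hasLaw_dotProduct_of_iIndepFun hl hi (unitVec z)

/-- For frozen (Z, E₁) the outcome score projects the residual error on a fixed unit vector. Its law
is therefore free of (Z, E₁), which makes it independent of the mediator score. -/
lemma Model.hasLaw_scores (h : Model P A B C σ₁ σ₂ δ Z M R E₁ E₂) (hσ₁ : 0 < σ₁)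
    (hδ : δ ∈ Set.Ioo (-1 : ℝ) 1) (hn : 0 < n) :
    HasLaw (fun ω => (mediatorScore (Z ω) (E₁ ω),
        outcomeScore (Z ω) (E₁ ω) (residualError σ₁ σ₂ δ (E₁ ω) (E₂ ω))))
      ((gaussianReal 0 (σ₁ ^ 2).toNNReal).prod
        (gaussianReal 0 (σ₂ ^ 2 * (1 - δ ^ 2)).toNNReal)) P := by
  obtain ⟨hl, hi⟩ := h.iid_residualError hσ₁ hδ
  obtain ⟨h1, h2⟩ := indepFun_hasLaw_of_map_eq
    (h.aemeasurable_treatment.prodMk h.aemeasurable_error) h.aemeasurable_residualError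
    (h.indepFun_prodMk_residualError hσ₁ hδ)
    (f := fun p : (Fin n → ℝ) × (Fin n → ℝ) => outcomeScore p.1 p.2)
    (ν := gaussianReal 0 (σ₂ ^ 2 * (1 - δ ^ 2)).toNNReal)
    (by unfold outcomeScore Function.uncurry; fun_prop)
    (fun p => by
      simpa [outcomeScore, unitVec_dotProduct_self hn] using
        hasLaw_dotProduct_of_iIndepFun hl hi (unitVec (orthPart p.1 p.2)))
  refine (indepFun_iff_hasLaw_prodMk_prod (h.hasLaw_mediatorScore hσ₁ hδ hn) h1).1 ?_
  exact h2.comp (φ := fun p : (Fin n → ℝ) × (Fin n → ℝ) => mediatorScore p.1 p.2)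
    (by unfold mediatorScore; fun_prop) measurable_id

/-- The equality case of Cauchy–Schwarz, written as a vanishing minor so that it is linear in `e`.
-/
lemma eq_of_gram_eq_zero {z e : Fin n → ℝ} (hg : gram z e = 0) (i j : Fin n) :
    z j * e i = z i * e j := by
  by_cases hz : z = 0
  · simp [hz]
  have h : orthPart z e = 0 := by
    have := orthPart_dotProduct_self z e
    rw [hg, mul_zero] at this
    simpa using this
  have hi := congrFun h i
  have hj := congrFun h j
  simp only [orthPart, Pi.sub_apply, Pi.smul_apply, smul_eq_mul, Pi.zero_apply] at hi hj
  refine mul_left_cancel₀ (dotProduct_self_pos' hz).ne' ?_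
  linear_combination z j * hi - z i * hj

/-- With two observations or more, the mediator error is almost surely not a multiple of a
nonzero treatment. -/
lemma Model.ae_gram_ne_zero (h : Model P A B C σ₁ σ₂ δ Z M R E₁ E₂) (hσ₁ : 0 < σ₁)
    (hδ : δ ∈ Set.Ioo (-1 : ℝ) 1) (hn : 2 ≤ n) :
    ∀ᵐ ω ∂P, Z ω ≠ 0 → gram (Z ω) (E₁ ω) ≠ 0 := by
  have := Measure.isProbabilityMeasure_map (μ := P) h.aemeasurable_treatment
  have := Measure.isProbabilityMeasure_map (μ := P) h.aemeasurable_error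
  have hlaw := (indepFun_iff_hasLaw_prodMk_prod ⟨h.aemeasurable_treatment, rfl⟩
    ⟨h.aemeasurable_error, rfl⟩).1 h.indepFun_treatment_error
  have hgm : Measurable (fun p : (Fin n → ℝ) × (Fin n → ℝ) => gram p.1 p.2) := by
    unfold gram
    fun_prop
  have hm : MeasurableSet {p : (Fin n → ℝ) × (Fin n → ℝ) | p.1 ≠ 0 → gram p.1 p.2 ≠ 0} := by
    have h1 : MeasurableSet {p : (Fin n → ℝ) × (Fin n → ℝ) | p.1 = 0} :=
      measurable_fst (measurableSet_singleton 0)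
    have h2 : MeasurableSet {p : (Fin n → ℝ) × (Fin n → ℝ) | gram p.1 p.2 = 0} :=
      hgm (measurableSet_singleton 0)
    convert! h1.union h2.compl using 1
    ext p
    simp [imp_iff_not_or]
  -- The joint law of (Z, E₁) is a product, so by Fubini the treatment can be frozen.
  refine (hlaw.ae_iff (measurableSet_setOfPred.1 hm)).2 ?_
  rw [Measure.ae_prod_iff_ae_ae hm]
  refine ae_of_all _ fun z => ?_
  by_cases hz : z = 0
  · exact ae_of_all _ fun e h0 => absurd hz h0
  obtain ⟨i, hi⟩ := Function.ne_iff.1 hz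
  have : Nontrivial (Fin n) := Fin.nontrivial_iff_two_le.2 hn
  obtain ⟨j, hj⟩ := exists_ne i
  obtain ⟨hl, hind⟩ := h.iid_error hσ₁ hδ
  -- Pairing this vector with `E₁` gives the minor that collinearity would annihilate. Its `j`-th
  -- entry is -`z i` ≠ 0, so the pairing is a nondegenerate Gaussian and has no atom at 0.
  have hw := hasLaw_dotProduct_of_iIndepFun hl hind (Pi.single i (z j) - Pi.single j (z i))
  have hv : ((Pi.single i (z j) - Pi.single j (z i) : Fin n → ℝ) ⬝ᵥ
      (Pi.single i (z j) - Pi.single j (z i))).toNNReal * (σ₁ ^ 2).toNNReal ≠ 0 := by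
    have hne : (Pi.single i (z j) - Pi.single j (z i) : Fin n → ℝ) ≠ 0 := by
      intro h0
      have := congrFun h0 j
      simp [hj] at this
      exact hi this
    refine mul_ne_zero ?_ ?_
    · exact (Real.toNNReal_pos.2 (dotProduct_self_pos' hne)).ne'
    · exact (Real.toNNReal_pos.2 (by positivity)).ne'
  have := nullSingletonClass_gaussianReal (μ := 0) hv
  have hne0 : ∀ᵐ ω ∂P, (Pi.single i (z j) - Pi.single j (z i) : Fin n → ℝ) ⬝ᵥ E₁ ω ≠ 0 := by
    refine ae_of_ae_map (p := fun x => x ≠ 0) hw.aemeasurable ?_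
    rw [hw.map_eq]
    exact Measure.ae_ne _ 0
  have hm' : MeasurableSet {e : Fin n → ℝ | z ≠ 0 → gram z e ≠ 0} :=
    measurable_prodMk_left hm
  rw [ae_map_iff h.aemeasurable_error hm']
  filter_upwards [hne0] with ω hω _ hg
  apply hω
  rw [sub_dotProduct, single_dotProduct, single_dotProduct, eq_of_gram_eq_zero hg i j, sub_self]

end Scores

/-! ### Measurability of the statistics -/

section Measurability

variable {Ω : Type*} [MeasurableSpace Ω] {P : Measure Ω}
  {A B C σ₁ σ₂ δ : ℝ} {n : ℕ} {Z M R E₁ E₂ : Ω → Fin n → ℝ}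

lemma Model.aemeasurable_mediator (h : Model P A B C σ₁ σ₂ δ Z M R E₁ E₂) :
    AEMeasurable M P := by
  rw [funext h.mediator_eq]
  exact (h.aemeasurable_treatment.const_smul A).add h.aemeasurable_error

lemma Model.aemeasurable_outcome (h : Model P A B C σ₁ σ₂ δ Z M R E₁ E₂) :
    AEMeasurable R P := by
  have hE : AEMeasurable E₂ P :=
    aemeasurable_pi_lambda _ fun i => (h.hasGaussianLaw_error_apply 1 i).aemeasurable
  rw [funext h.outcome_eq]
  exact ((h.aemeasurable_treatment.const_smul C).add (h.aemeasurable_mediator.const_smul B)).add hE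

lemma Model.aemeasurable_productEst (h : Model P A B C σ₁ σ₂ δ Z M R E₁ E₂) :
    AEMeasurable (fun ω => productEst σ₁ σ₂ δ (Z ω) (M ω) (R ω)) P := by
  have h1 := h.aemeasurable_treatment
  have h2 := h.aemeasurable_mediator
  have h3 := h.aemeasurable_outcome
  unfold productEst hatA hatB
  fun_prop

lemma Model.aemeasurable_differenceEst (h : Model P A B C σ₁ σ₂ δ Z M R E₁ E₂) :
    AEMeasurable (fun ω => differenceEst σ₁ σ₂ δ (Z ω) (M ω) (R ω)) P := by
  have h1 := h.aemeasurable_treatment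
  have h2 := h.aemeasurable_mediator
  have h3 := h.aemeasurable_outcome
  unfold differenceEst hatC' hatC
  fun_prop

lemma aemeasurable_mediatorScore (hZ : AEMeasurable Z P) (hE : AEMeasurable E₁ P) :
    AEMeasurable (fun ω => mediatorScore (Z ω) (E₁ ω)) P := by
  have : Measurable (fun p : (Fin n → ℝ) × (Fin n → ℝ) => mediatorScore p.1 p.2) := by
    unfold mediatorScore
    fun_prop
  exact (this.comp_aemeasurable (hZ.prodMk hE) :)

lemma aemeasurable_outcomeScore {X : Ω → Fin n → ℝ} (hZ : AEMeasurable Z P)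
    (hE : AEMeasurable E₁ P) (hX : AEMeasurable X P) :
    AEMeasurable (fun ω => outcomeScore (Z ω) (E₁ ω) (X ω)) P := by
  have : Measurable (fun p : ((Fin n → ℝ) × (Fin n → ℝ)) × (Fin n → ℝ) =>
      outcomeScore p.1.1 p.1.2 p.2) := by
    unfold outcomeScore
    fun_prop
  exact (this.comp_aemeasurable ((hZ.prodMk hE).prodMk hX) :)

end Measurability

/-! ### Slutsky's theorem and the limit laws -/

section Limits

variable {Ω : Type*} [MeasurableSpace Ω] {P : Measure Ω} [IsProbabilityMeasure P]

lemma tendstoInDistribution_id_of_hasLaw {E Ω' : Type*} [TopologicalSpace E] [MeasurableSpace E]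
    [OpensMeasurableSpace E] [MeasurableSpace Ω'] {μ : Measure Ω'} [IsProbabilityMeasure μ]
    {X : ℕ → Ω → E} {W : Ω' → E} {ν : Measure E} [IsProbabilityMeasure ν]
    (hX : TendstoInDistribution X atTop W (fun _ => P) μ) (hW : HasLaw W ν μ) :
    TendstoInDistribution X atTop (id : E → E) (fun _ => P) ν where
  forall_aemeasurable := hX.forall_aemeasurable
  aemeasurable_limit := aemeasurable_id
  tendsto := by
    have h := hX.tendsto
    simp only [hW.map_eq] at h
    simpa only [Measure.map_id] using h

lemma hasLaw_linear_prod_gaussianReal (v w : NNReal) (a b : ℝ) :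
    HasLaw (fun p : ℝ × ℝ => a * p.1 + b * p.2)
      (gaussianReal 0 ((a ^ 2).toNNReal * v + (b ^ 2).toNNReal * w))
      ((gaussianReal 0 v).prod (gaussianReal 0 w)) := by
  have h1 : HasLaw (fun p : ℝ × ℝ => a * p.1) (gaussianReal (a * 0) (.mk (a ^ 2) (sq_nonneg _) * v))
      ((gaussianReal 0 v).prod (gaussianReal 0 w)) :=
    gaussianReal_const_mul measurePreserving_fst.hasLaw a
  have h2 : HasLaw (fun p : ℝ × ℝ => b * p.2) (gaussianReal (b * 0) (.mk (b ^ 2) (sq_nonneg _) * w))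
      ((gaussianReal 0 v).prod (gaussianReal 0 w)) :=
    gaussianReal_const_mul measurePreserving_snd.hasLaw b
  refine ⟨by fun_prop, ?_⟩
  have := gaussianReal_add_gaussianReal_of_indepFun
    (indepFun_prod (measurable_const_mul a) (measurable_const_mul b)) h1.map_eq h2.map_eq
  convert! this using 2
  · simp
  · congr 2 <;> exact Subtype.ext (Real.coe_toNNReal _ (sq_nonneg _))

omit [IsProbabilityMeasure P] in
lemma tendstoInMeasure_sqrt_inv {X : ℕ → Ω → ℝ} {c : ℝ} (hc : c ≠ 0)
    (hX : TendstoInMeasure P X atTop (fun _ => c)) :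
    TendstoInMeasure P (fun n ω => √(X n ω)⁻¹) atTop (fun _ => √c⁻¹) :=
  tendstoInMeasure_comp_continuousAt (f := fun x : ℝ => √x⁻¹)
    (Real.continuous_sqrt.continuousAt.comp (continuousAt_inv₀ hc)) hX

omit [IsProbabilityMeasure P] in
lemma tendstoInMeasure_sqrt_inv_sub_sq {X Y : ℕ → Ω → ℝ} {c d : ℝ} (hcd : c - d ^ 2 ≠ 0)
    (hX : TendstoInMeasure P X atTop (fun _ => c)) (hY : TendstoInMeasure P Y atTop (fun _ => d)) :
    TendstoInMeasure P (fun n ω => √(X n ω - Y n ω ^ 2)⁻¹) atTop (fun _ => √(c - d ^ 2)⁻¹) := by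
  have hf : ContinuousAt (fun x : ℝ × ℝ => x.1 - x.2 ^ 2) (c, d) := by fun_prop
  have h := tendstoInMeasure_comp_continuousAt hf (tendstoInMeasure_prodMk hX hY)
  exact tendstoInMeasure_sqrt_inv hcd h

/-- Slutsky: the scores have a constant law and their coefficients have constant limits. In the
limit the inverse rate is 0, the cross term disappears and a linear form in two independent
Gaussians is left. -/
lemma tendstoInDistribution_expansion (A B : ℝ) {G H S T : ℕ → Ω → ℝ} {v w : NNReal} {s t : ℝ}
    (hGm : ∀ n, AEMeasurable (fun ω => (G n ω, H n ω)) P)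
    (hG : ∀ᶠ n in atTop, HasLaw (fun ω => (G n ω, H n ω))
      ((gaussianReal 0 v).prod (gaussianReal 0 w)) P)
    (hS : TendstoInMeasure P S atTop (fun _ => s)) (hSm : ∀ n, AEMeasurable (S n) P)
    (hT : TendstoInMeasure P T atTop (fun _ => t)) (hTm : ∀ n, AEMeasurable (T n) P) :
    TendstoInDistribution
      (fun n ω => expansion B A ((G n ω, H n ω), ((S n ω, T n ω), (√(n : ℝ))⁻¹)))
      atTop (id : ℝ → ℝ) (fun _ => P)
      (gaussianReal 0 (((B * s) ^ 2).toNNReal * v + ((A * t) ^ 2).toNNReal * w)) := by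
  have hc : TendstoInMeasure P (fun (n : ℕ) (_ : Ω) => (√(n : ℝ))⁻¹) atTop (fun _ => 0) := by
    refine tendstoInMeasure_of_tendsto_ae (fun n => aestronglyMeasurable_const)
      (ae_of_all _ fun ω => ?_)
    exact tendsto_inv_atTop_zero.comp
      (Real.tendsto_sqrt_atTop.comp tendsto_natCast_atTop_atTop)
  have hslutsky := (tendstoInDistribution_of_eventually_hasLaw
    hGm hG).continuous_comp_prodMk_of_tendstoInMeasure_const
    (continuous_expansion B A) (tendstoInMeasure_prodMk (tendstoInMeasure_prodMk hS hT) hc)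
    (fun n => ((hSm n).prodMk (hTm n)).prodMk aemeasurable_const)
  refine tendstoInDistribution_id_of_hasLaw hslutsky
    ((hasLaw_linear_prod_gaussianReal v w (B * s) (A * t)).congr (ae_of_all _ fun p => ?_))
  simp [expansion]
  ring

variable {A B C σ₁ σ₂ δ q : ℝ} {Z M R E₁ E₂ : (n : ℕ) → Ω → Fin n → ℝ}

omit [IsProbabilityMeasure P] in
-- Where the treatment vanishes the ratio is 0, at distance exactly q from its limit; hence ε = q.
lemma tendsto_measure_eq_zero (hq : 0 < q)
    (hZ : TendstoInMeasure P (fun n ω => (Z n ω ⬝ᵥ Z n ω) / (n : ℝ)) atTop (fun _ => q)) :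
    Tendsto (fun n => P {ω | Z n ω = 0}) atTop (𝓝 0) := by
  refine tendsto_of_tendsto_of_tendsto_of_le_of_le tendsto_const_nhds
    (tendstoInMeasure_iff_norm.1 hZ q hq) (fun _ => zero_le) fun n => measure_mono fun ω hω => ?_
  have h0 : Z n ω = 0 := hω
  simp [h0, abs_of_pos hq]

omit [IsProbabilityMeasure P] in
/-- Statistics that agree almost surely when the treatment does not vanish are asymptotically
equal. -/
lemma tendstoInMeasure_sub_of_ae_eq (hq : 0 < q)
    (hZ : TendstoInMeasure P (fun n ω => (Z n ω ⬝ᵥ Z n ω) / (n : ℝ)) atTop (fun _ => q))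
    {S T : ℕ → Ω → ℝ} (hST : ∀ n, 2 ≤ n → ∀ᵐ ω ∂P, Z n ω ≠ 0 → S n ω = T n ω) :
    TendstoInMeasure P (S - T) atTop 0 := by
  refine tendstoInMeasure_sub_of_measure_ne ?_
  refine tendsto_of_tendsto_of_tendsto_of_le_of_le' tendsto_const_nhds
    (tendsto_measure_eq_zero hq hZ) (Eventually.of_forall fun _ => zero_le) ?_
  filter_upwards [eventually_ge_atTop 2] with n hn
  refine measure_mono_ae ?_
  filter_upwards [hST n hn] with ω hω hne
  by_contra h0
  exact hne (hω h0)

variable (hσ₁ : 0 < σ₁) (hδ : δ ∈ Set.Ioo (-1 : ℝ) 1)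
  (hmodel : ∀ n, Model P A B C σ₁ σ₂ δ (Z n) (M n) (R n) (E₁ n) (E₂ n))

include hσ₁ hδ hmodel

lemma tendstoInMeasure_error_mean_sq :
    TendstoInMeasure P (fun n ω => (E₁ n ω ⬝ᵥ E₁ n ω) / (n : ℝ)) atTop (fun _ => σ₁ ^ 2) := by
  have key (n : ℕ) := variance_dotProduct_self ((hmodel n).iid_error hσ₁ hδ).1
    ((hmodel n).iid_error hσ₁ hδ).2
  simp only [Fintype.card_fin, Real.coe_toNNReal _ (sq_nonneg σ₁)] at key
  simp only [div_eq_inv_mul]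
  refine tendstoInMeasure_of_variance_tendsto_zero (fun n => (key n).1.const_mul _) ?_ ?_
  · filter_upwards [eventually_gt_atTop 0] with n hn
    have hn' : (n : ℝ) ≠ 0 := by exact_mod_cast hn.ne'
    rw [integral_const_mul, (key n).2.1]
    field_simp
  -- The value of `K` is irrelevant: the mean of n squares has variance `K`/n.
  · set K := Var[fun x => x ^ 2; gaussianReal 0 (σ₁ ^ 2).toNNReal] with hK
    have : Tendsto (fun n : ℕ => K * (n : ℝ)⁻¹) atTop (𝓝 0) := by
      simpa using (tendsto_inv_atTop_nhds_zero_nat (𝕜 := ℝ)).const_mul K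
    refine this.congr' ?_
    filter_upwards [eventually_gt_atTop 0] with n hn
    have hn' : (n : ℝ) ≠ 0 := by exact_mod_cast hn.ne'
    rw [variance_const_mul, (key n).2.2]
    field_simp

lemma tendstoInMeasure_mediatorScore_div_sqrt :
    TendstoInMeasure P (fun n ω => mediatorScore (Z n ω) (E₁ n ω) / √(n : ℝ)) atTop
      (fun _ => 0) := by
  -- With no observations the score is an empty sum, so n = 0 escapes the Gaussian law and needs its
  -- own integrability argument.
  have h0 : ∀ ω, mediatorScore (Z 0 ω) (E₁ 0 ω) = 0 := fun ω => by simp [mediatorScore]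
  simp only [div_eq_inv_mul]
  have hl (n : ℕ) (hn : 0 < n) := (hmodel n).hasLaw_mediatorScore hσ₁ hδ hn
  refine tendstoInMeasure_of_variance_tendsto_zero (fun n => MemLp.const_mul ?_ _) ?_ ?_
  · rcases n.eq_zero_or_pos with rfl | hn
    · simp [h0]
    · exact (hl n hn).hasGaussianLaw.memLp_two
  · filter_upwards [eventually_gt_atTop 0] with n hn
    rw [integral_const_mul, (hl n hn).integral_eq, integral_id_gaussianReal, mul_zero]
  · have : Tendsto (fun n : ℕ => σ₁ ^ 2 * (n : ℝ)⁻¹) atTop (𝓝 0) := by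
      simpa using (tendsto_inv_atTop_nhds_zero_nat (𝕜 := ℝ)).const_mul (σ₁ ^ 2)
    refine this.congr' ?_
    filter_upwards [eventually_gt_atTop 0] with n hn
    rw [variance_const_mul, (hl n hn).variance_eq, variance_id_gaussianReal, inv_pow,
      Real.sq_sqrt (Nat.cast_nonneg n), Real.coe_toNNReal _ (sq_nonneg σ₁), mul_comm]

lemma tendstoInDistribution_expansion_scores (hq : 0 < q)
    (hZ : TendstoInMeasure P (fun n ω => (Z n ω ⬝ᵥ Z n ω) / (n : ℝ)) atTop (fun _ => q)) :
    TendstoInDistribution (fun n ω => expansion B A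
        ((mediatorScore (Z n ω) (E₁ n ω),
            outcomeScore (Z n ω) (E₁ n ω) (residualError σ₁ σ₂ δ (E₁ n ω) (E₂ n ω))),
          ((√((Z n ω ⬝ᵥ Z n ω) / n)⁻¹,
            √((E₁ n ω ⬝ᵥ E₁ n ω) / n - (mediatorScore (Z n ω) (E₁ n ω) / √(n : ℝ)) ^ 2)⁻¹),
            (√(n : ℝ))⁻¹)))
      atTop (id : ℝ → ℝ) (fun _ => P)
      (gaussianReal 0
        (σ₁ ^ 2 / q * B ^ 2 + σ₂ ^ 2 * (1 - δ ^ 2) / σ₁ ^ 2 * A ^ 2).toNNReal) := by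
  have hδ' : 0 ≤ 1 - δ ^ 2 := by nlinarith [hδ.1, hδ.2]
  have hmZ (n : ℕ) := (hmodel n).aemeasurable_treatment
  have hmE (n : ℕ) := (hmodel n).aemeasurable_error
  have hmG (n : ℕ) := aemeasurable_mediatorScore (hmZ n) (hmE n)
  have hmH (n : ℕ) := aemeasurable_outcomeScore (hmZ n) (hmE n)
    (hmodel n).aemeasurable_residualError
  -- The limit of the mean square of `E₁` minus the squared limit 0 of the mediator score over √n.
  have hv : σ₁ ^ 2 - 0 ^ 2 ≠ 0 := by simpa using hσ₁.ne'
  have hmb (n : ℕ) : AEMeasurable (fun ω => (E₁ n ω ⬝ᵥ E₁ n ω) / (n : ℝ)) P :=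
    (aemeasurable_dotProduct (hmE n) (hmE n)).div_const _
  have hma (n : ℕ) : AEMeasurable (fun ω => (Z n ω ⬝ᵥ Z n ω) / (n : ℝ)) P :=
    (aemeasurable_dotProduct (hmZ n) (hmZ n)).div_const _
  have hslutsky := tendstoInDistribution_expansion A B
    (fun n => (hmG n).prodMk (hmH n))
    ((eventually_gt_atTop 0).mono fun n hn => (hmodel n).hasLaw_scores hσ₁ hδ hn)
    (tendstoInMeasure_sqrt_inv hq.ne' hZ)
    (fun n => (hma n).inv.sqrt)
    (tendstoInMeasure_sqrt_inv_sub_sq hv (tendstoInMeasure_error_mean_sq hσ₁ hδ hmodel)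
      (tendstoInMeasure_mediatorScore_div_sqrt hσ₁ hδ hmodel))
    (fun n => ((hmb n).sub (((hmG n).div_const _).pow_const 2)).inv.sqrt)
  have hvar : ((B * √q⁻¹) ^ 2).toNNReal * (σ₁ ^ 2).toNNReal +
      ((A * √(σ₁ ^ 2 - 0 ^ 2)⁻¹) ^ 2).toNNReal * (σ₂ ^ 2 * (1 - δ ^ 2)).toNNReal =
      (σ₁ ^ 2 / q * B ^ 2 + σ₂ ^ 2 * (1 - δ ^ 2) / σ₁ ^ 2 * A ^ 2).toNNReal := by
    rw [← Real.toNNReal_mul (by positivity), ← Real.toNNReal_mul (by positivity),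
      ← Real.toNNReal_add (by positivity) (by positivity), mul_pow, mul_pow,
      Real.sq_sqrt (by positivity), Real.sq_sqrt (by simp; positivity)]
    congr 1
    simp only [ne_eq, OfNat.ofNat_ne_zero, not_false_eq_true, zero_pow, sub_zero]
    ring
  rwa [hvar] at hslutsky

lemma asymptoticallyNormal_productEst (hq : 0 < q)
    (hZ : TendstoInMeasure P (fun n ω => (Z n ω ⬝ᵥ Z n ω) / (n : ℝ)) atTop (fun _ => q)) :
    AsymptoticallyNormal P (fun n ω => productEst σ₁ σ₂ δ (Z n ω) (M n ω) (R n ω)) (A * B)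
      (σ₁ ^ 2 / q * B ^ 2 + σ₂ ^ 2 * (1 - δ ^ 2) / σ₁ ^ 2 * A ^ 2) := by
  have hδ' : 0 ≤ 1 - δ ^ 2 := by nlinarith [hδ.1, hδ.2]
  refine ⟨by positivity, tendstoInDistribution_of_tendstoInMeasure_sub _ _
    (tendstoInDistribution_expansion_scores hσ₁ hδ hmodel hq hZ)
    (tendstoInMeasure_sub_of_ae_eq hq hZ fun n hn => ?_) fun n => ?_⟩
  · filter_upwards [(hmodel n).ae_gram_ne_zero hσ₁ hδ hn] with ω hω hz
    exact sqrt_mul_productEst_sub (by omega) ((hmodel n).mediator_eq ω)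
      ((hmodel n).outcome_eq ω) hz (hω hz)
  · exact ((hmodel n).aemeasurable_productEst.sub_const _).const_mul _

end Limits

end Mediation

theorem corollary1 {Ω : Type*} [MeasurableSpace Ω] (P : Measure Ω) [IsProbabilityMeasure P]
    (A B C σ₁ σ₂ δ q : ℝ) (hσ₁ : 0 < σ₁) (hσ₂ : 0 < σ₂) (hδ : δ ∈ Set.Ioo (-1 : ℝ) 1) (hq : 0 < q)
    (Z M R E₁ E₂ : (n : ℕ) → Ω → Fin n → ℝ)
    (hmodel : ∀ n, Mediation.Model P A B C σ₁ σ₂ δ (Z n) (M n) (R n) (E₁ n) (E₂ n))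
    (hZ : TendstoInMeasure P (fun n ω => (Z n ω ⬝ᵥ Z n ω) / (n : ℝ)) atTop (fun _ => q)) :
    -- the closed-form estimators are the constrained maximum likelihood estimators
    (∀ n, 2 ≤ n → ∀ᵐ ω ∂P, Z n ω ≠ 0 → ∀ Θ : Matrix (Fin 2) (Fin 2) ℝ,
      Mediation.IsConstrainedMLE (Mediation.errorCov σ₁ σ₂ δ) (Z n ω) (M n ω) (R n ω) Θ ↔
        Θ = !![Mediation.hatA (Z n ω) (M n ω), Mediation.hatC σ₁ σ₂ δ (Z n ω) (M n ω) (R n ω);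
              0, Mediation.hatB σ₁ σ₂ δ (Z n ω) (M n ω) (R n ω)]) ∧
    -- the two estimators of the indirect effect are asymptotically equivalent
    Mediation.AsymptoticallyEquivalent P
      (fun n ω => Mediation.productEst σ₁ σ₂ δ (Z n ω) (M n ω) (R n ω))
      (fun n ω => Mediation.differenceEst σ₁ σ₂ δ (Z n ω) (M n ω) (R n ω)) ∧
    -- both are asymptotically normal, with the same variance
    Mediation.AsymptoticallyNormal P
      (fun n ω => Mediation.productEst σ₁ σ₂ δ (Z n ω) (M n ω) (R n ω)) (A * B)
      (σ₁ ^ 2 / q * B ^ 2 + σ₂ ^ 2 * (1 - δ ^ 2) / σ₁ ^ 2 * A ^ 2) ∧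
    Mediation.AsymptoticallyNormal P
      (fun n ω => Mediation.differenceEst σ₁ σ₂ δ (Z n ω) (M n ω) (R n ω)) (A * B)
      (σ₁ ^ 2 / q * B ^ 2 + σ₂ ^ 2 * (1 - δ ^ 2) / σ₁ ^ 2 * A ^ 2) := by
  have hgram (n : ℕ) (hn : 2 ≤ n) :
      ∀ᵐ ω ∂P, Z n ω ≠ 0 → Mediation.gram (Z n ω) (M n ω) ≠ 0 := by
    filter_upwards [(hmodel n).ae_gram_ne_zero hσ₁ hδ hn] with ω hω hz
    rw [(hmodel n).mediator_eq ω, Mediation.gram_smul_add]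
    exact hω hz
  have heq (n : ℕ) (hn : 2 ≤ n) : ∀ᵐ ω ∂P, Z n ω ≠ 0 →
      Mediation.differenceEst σ₁ σ₂ δ (Z n ω) (M n ω) (R n ω) =
        Mediation.productEst σ₁ σ₂ δ (Z n ω) (M n ω) (R n ω) := by
    filter_upwards [hgram n hn] with ω hω hz
    exact Mediation.differenceEst_eq_productEst hσ₁.ne' hz (hω hz)
  have hprod := Mediation.asymptoticallyNormal_productEst hσ₁ hδ hmodel hq hZ
  refine ⟨fun n hn => ?_, ?_, hprod, hprod.1, ?_⟩
  · filter_upwards [hgram n hn] with ω hω hz Θ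
    exact Mediation.isConstrainedMLE_iff hσ₁.ne' hσ₂.ne' hδ hz (hω hz) Θ
  -- For n ≥ 2 the estimators agree exactly, almost surely on Z ≠ 0, so the factor √n costs nothing.
  · have := Mediation.tendstoInMeasure_sub_of_ae_eq hq hZ (T := 0)
      (S := fun n ω => √(n : ℝ) * (Mediation.productEst σ₁ σ₂ δ (Z n ω) (M n ω) (R n ω) -
        Mediation.differenceEst σ₁ σ₂ δ (Z n ω) (M n ω) (R n ω))) fun n hn => by
      filter_upwards [heq n hn] with ω hω hz
      simp [hω hz]
    rwa [sub_zero] at this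
  · refine tendstoInDistribution_of_tendstoInMeasure_sub _ _ hprod.2
      (Mediation.tendstoInMeasure_sub_of_ae_eq hq hZ fun n hn => ?_) fun n => ?_
    · filter_upwards [heq n hn] with ω hω hz
      rw [hω hz]
    · exact ((hmodel n).aemeasurable_differenceEst.sub_const _).const_mul _
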